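/- A \emph{semilattice} is a meet-semilattice $\mathbf A=\langle A,\wedge,1\rangle$ with greatest element $1$; homomorphisms preserve $\wedge$ and $1$. A \emph{modal semilattice} is a pair $\langle \mathbf A,d\rangle$ with $d\colon A\to A$ such that $d(1)=1$ and $d(a\wedge b)=d(a)\wedge d(b)$. Let $\mathsf{MoSL}$ be the category of modal semilattices, whose morphisms $\langle\mathbf A,d\rangle\to\langle\mathbf B,n\rangle$ are the semilattice homomorphisms $h$ with $h(d(a))=n(h(a))$ for all $a\in A$. For a set $X$ and $\mathcal K\subseteq\mathcal P(X)$ put $S(X)=\{U^c: U\in\mathcal K\}$ and give $X$ the topology with subbase $\mathcal K$. For $Y\subseteq X$, a family $\mathcal J\subseteq S(X)$ is a \emph{$Y$-family} if for all $A,B\in\mathcal J$ there are $H\in S(X)$ and $C\in\mathcal J$ with $Y\subseteq H$, $A\cap H\subseteq C$ and $B\cap H\subseteq C$. The pair $\langle X,\mathcal K\rangle$ is an \emph{S-space} if (S1) it is $T_0$ and $X=\bigcup\mathcal K$; (S2) the members of $\mathcal K$ are compact, $\mathcal K$ is closed under finite unions, and $\emptyset\in\mathcal K$; (S3) if $x\in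 U\cap V$ with $U,V\in\mathcal K$, there are $W,D\in\mathcal K$ with $x\notin W$, $x\in D$ and $D\subseteq(U\cap V)\cup W$; (S4) if $Y$ is an intersection of members of $S(X)$ and $\mathcal J$ is a non-empty $Y$-family with $Y\cap A^c\neq\emptyset$ for all $A\in\mathcal J$, then $Y\cap\bigcap\{A^c:A\in\mathcal J\}\neq\emptyset$. For $T\subseteq X\times Y$ write $T(x)=\{y:(x,y)\in T\}$ and $\Box_T(U)=\{x: T(x)\subseteq U\}$. A \emph{meet-relation} between S-spaces $X$ and $Y$ is a relation $T\subseteq X\times Y$ such that $\Box_T(U)\in S(X)$ for all $U\in S(Y)$ and $T(x)=\bigcap\{U\in S(Y):T(x)\subseteq U\}$ for all $x\in X$. The composition of meet-relations $R\subseteq X\times Y$ and $T\subseteq Y\times Z$ is $$T*R=\{(x,z):\forall U\in S(Z)\ ((T\circ R)(x)\subseteq U\Rightarrow z\in U)\}.$$ A \emph{MoS-space} is a triple $\langle X,\mathcal K,T\rangle$ where $\langle X,\mathcal K\rangle$ is an S-space and $T\subseteq X\times X$ is a meet-relation. Let $\mathsf{MoSsp}$ be the category of MoS-spaces, whose morphisms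 $\langle X_1,\mathcal K_1,T_1\rangle\to\langle X_2,\mathcal K_2,T_2\rangle$ are the meet-relations $M\subseteq X_1\times X_2$ with $M*T_1=T_2*M$; composition is $*$, and the identity of $X$ is the dual specialization order $\{(x,y): y\in\bigcap\{U\in S(X):x\in U\}\}$. \textbf{Theorem.} The categories $\mathsf{MoSL}$ and $\mathsf{MoSsp}$ are dually equivalent. More precisely, the functors $$\mathbf F\colon\mathsf{MoSsp}\to\mathsf{MoSL}^{op},\quad \langle X,\mathcal K,T\rangle\mapsto\langle\langle S(X),\cap,X\rangle,\Box_T\rangle,\quad M\mapsto\Box_M,$$ $$\mathbf G\colon\mathsf{MoSL}^{op}\to\mathsf{MoSsp},\quad \langle\mathbf A,d\rangle\mapsto\langle\mathcal X(\mathbf A),\{\beta(a)^c:a\in A\},N_d\rangle,\quad h\mapsto N_h,$$ are mutually inverse up to natural isomorphism. Here a filter of $\mathbf A$ is an upset that contains $1$ and is closed under $\wedge$; $\mathcal X(\mathbf A)$ is the set of \emph{irreducible filters} of $\mathbf A$, that is, proper filters $P$ such that $P=F_1\cap F_2$ with filters $F_1,F_2$ implies $P=F_1$ or $P=F_2$;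 $\beta(a)=\{P\in\mathcal X(\mathbf A):a\in P\}$; and, for $h\colon\mathbf A\to\mathbf B$, $N_h=\{(P,Q)\in\mathcal X(\mathbf B)\times\mathcal X(\mathbf A): h^{-1}[P]\subseteq Q\}$. -/

import Mathlib

open CategoryTheory

universe u

namespace ModalDuality

/-! ### S-spaces and meet-relations -/

section Spaces

variable {X Y Z W : Type u}

/-- `S(X)`: the complements of the members of the subbase `K`. -/
def subClosed (K : Set (Set X)) : Set (Set X) := {A | ∃ U ∈ K, A = Uᶜ}

theorem mem_subClosed {K : Set (Set X)} {A : Set X} : A ∈ subClosed K ↔ Aᶜ ∈ K := by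
  constructor
  · rintro ⟨U, hU, rfl⟩
    simpa using hU
  · intro h
    exact ⟨Aᶜ, h, by simp⟩

/-- `C_K(X)`: the closure system generated by `S(X)`. -/
def closureSystem (K : Set (Set X)) : Set (Set X) := {Y | ∃ 𝒜 ⊆ subClosed K, Y = ⋂₀ 𝒜}

/-- A family `J ⊆ S(X)` is a `Y`-family if any `A, B ∈ J` admit `H ∈ S(X)` and `C ∈ J` with
`Y ⊆ H`, `A ∩ H ⊆ C` and `B ∩ H ⊆ C`. -/
def IsFamily (K : Set (Set X)) (Y : Set X) (J : Set (Set X)) : Prop :=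
  J ⊆ subClosed K ∧
    ∀ A ∈ J, ∀ B ∈ J, ∃ H ∈ subClosed K, ∃ C ∈ J, Y ⊆ H ∧ A ∩ H ⊆ C ∧ B ∩ H ⊆ C

/-- `⟨X, K⟩` is an S-space. The topology of `X` is the one with subbase `K`. In `s4` the family `J`
is non-empty: the empty family together with `Y = ∅` would violate the conclusion in every space. -/
structure IsSSpace (K : Set (Set X)) : Prop where
  t0 : @T0Space X (TopologicalSpace.generateFrom K)
  sUnion_eq : ⋃₀ K = Set.univ
  isCompact : ∀ U ∈ K, @IsCompact X (TopologicalSpace.generateFrom K) U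
  union_mem : ∀ U ∈ K, ∀ V ∈ K, U ∪ V ∈ K
  empty_mem : ∅ ∈ K
  s3 : ∀ U ∈ K, ∀ V ∈ K, ∀ x ∈ U ∩ V, ∃ W ∈ K, ∃ D ∈ K, x ∉ W ∧ x ∈ D ∧ D ⊆ (U ∩ V) ∪ W
  s4 : ∀ Y ∈ closureSystem K, ∀ J : Set (Set X), J.Nonempty → IsFamily K Y J →
    (∀ A ∈ J, (Y ∩ Aᶜ).Nonempty) → (Y ∩ ⋂ A ∈ J, Aᶜ).Nonempty

/-- `T(x)`, the set of `T`-successors of `x`. -/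
def fiber (T : SetRel X Y) (x : X) : Set Y := {y | (x, y) ∈ T}

/-- `□_T(U) = {x | T(x) ⊆ U}`. -/
def box (T : SetRel X Y) (U : Set Y) : Set X := {x | fiber T x ⊆ U}

/-- `T ⊆ X × Y` is a meet-relation between `⟨X, K⟩` and `⟨Y, L⟩`. -/
structure IsMeetRel (K : Set (Set X)) (L : Set (Set Y)) (T : SetRel X Y) : Prop where
  box_mem : ∀ U ∈ subClosed L, box T U ∈ subClosed K
  fiber_eq : ∀ x, fiber T x = ⋂₀ {U | U ∈ subClosed L ∧ fiber T x ⊆ U}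

/-- The composition `T ∗ R`, for `R ⊆ X × Y` and `T ⊆ Y × Z`, where `L` is the subbase of `Z`;
`R.comp T` is the usual composition `T ∘ R`. -/
def star (L : Set (Set Z)) (T : SetRel Y Z) (R : SetRel X Y) : SetRel X Z :=
  {p | ∀ U ∈ subClosed L, fiber (R.comp T) p.1 ⊆ U → p.2 ∈ U}

/-- The `K`-closure of a set, `⋂ {U ∈ S(X) | A ⊆ U}`. -/
def clK (K : Set (Set X)) (A : Set X) : Set X := ⋂₀ {U | U ∈ subClosed K ∧ A ⊆ U}

/-- The dual specialization order `⊒` as a relation: `x ⊒ y` iff `y` is in the closure of `x`. -/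
def dualSpec (K : Set (Set X)) : SetRel X X := {p | p.2 ∈ clK K {p.1}}

theorem fiber_dualSpec_subset (K : Set (Set X)) {x : X} {U : Set X} (hU : U ∈ subClosed K) :
    fiber (dualSpec K) x ⊆ U ↔ x ∈ U := by
  constructor
  · intro h
    apply h
    rintro V ⟨-, hV⟩
    exact hV rfl
  · intro h y hy
    exact hy U ⟨hU, by simpa using h⟩

theorem box_dualSpec (K : Set (Set X)) {U : Set X} (hU : U ∈ subClosed K) :
    box (dualSpec K) U = U := by
  ext x
  exact fiber_dualSpec_subset K hU

theorem isMeetRel_dualSpec (K : Set (Set X)) : IsMeetRel K K (dualSpec K) where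
  box_mem U hU := by rwa [box_dualSpec K hU]
  fiber_eq x := by
    apply Set.Subset.antisymm
    · rintro y hy U ⟨-, hU⟩
      exact hU hy
    · rintro y hy U ⟨hU, hx⟩
      exact hy U ⟨hU, (fiber_dualSpec_subset K hU).2 (by simpa using hx)⟩

/-- A meet-relation is determined by its box operator. -/
theorem IsMeetRel.ext {K : Set (Set X)} {L : Set (Set Y)} {T T' : SetRel X Y}
    (h : IsMeetRel K L T) (h' : IsMeetRel K L T')
    (hb : ∀ U ∈ subClosed L, box T U = box T' U) : T = T' := by
  have key : ∀ x, fiber T x = fiber T' x := by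
    intro x
    rw [h.fiber_eq x, h'.fiber_eq x]
    congr 1
    ext U
    refine and_congr_right fun hU => ?_
    exact Set.ext_iff.1 (hb U hU) x
  ext ⟨x, y⟩
  exact Set.ext_iff.1 (key x) y

theorem box_comp (T : SetRel Y Z) (R : SetRel X Y) (U : Set Z) :
    box (R.comp T) U = box R (box T U) := by
  ext x
  constructor
  · intro h y hy z hz
    exact h ⟨y, hy, hz⟩
  · rintro h z ⟨y, hy, hz⟩
    exact h hy hz

theorem fiber_star_subset (L : Set (Set Z)) (T : SetRel Y Z) (R : SetRel X Y) {x : X}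
    {U : Set Z} (hU : U ∈ subClosed L) :
    fiber (star L T R) x ⊆ U ↔ fiber (R.comp T) x ⊆ U := by
  constructor
  · intro h z hz
    exact h fun V _ hV => hV hz
  · intro h z hz
    exact hz U hU h

theorem box_star (L : Set (Set Z)) (T : SetRel Y Z) (R : SetRel X Y) {U : Set Z}
    (hU : U ∈ subClosed L) : box (star L T R) U = box R (box T U) := by
  rw [← box_comp]
  ext x
  exact fiber_star_subset L T R hU

theorem IsMeetRel.star {K : Set (Set X)} {L : Set (Set Y)} {N : Set (Set Z)}
    {T : SetRel Y Z} {R : SetRel X Y} (hT : IsMeetRel L N T) (hR : IsMeetRel K L R) :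
    IsMeetRel K N (star N T R) where
  box_mem U hU := by
    rw [box_star N T R hU]
    exact hR.box_mem _ (hT.box_mem _ hU)
  fiber_eq x := by
    apply Set.Subset.antisymm
    · rintro y hy U ⟨-, hU⟩
      exact hU hy
    · intro y hy U hU hx
      exact hy U ⟨hU, (fiber_star_subset N T R hU).2 hx⟩

theorem star_dualSpec {K : Set (Set X)} {L : Set (Set Y)} {T : SetRel X Y}
    (hT : IsMeetRel K L T) : star L T (dualSpec K) = T := by
  refine (hT.star (isMeetRel_dualSpec K)).ext hT fun U hU => ?_
  rw [box_star L _ _ hU, box_dualSpec K (hT.box_mem U hU)]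

theorem dualSpec_star {K : Set (Set X)} {L : Set (Set Y)} {T : SetRel X Y}
    (hT : IsMeetRel K L T) : star L (dualSpec L) T = T := by
  refine ((isMeetRel_dualSpec L).star hT).ext hT fun U hU => ?_
  rw [box_star L _ _ hU, box_dualSpec L hU]

theorem star_assoc {K : Set (Set X)} {L : Set (Set Y)} {N : Set (Set Z)} {O : Set (Set W)}
    {R : SetRel X Y} {S : SetRel Y Z} {T : SetRel Z W}
    (hR : IsMeetRel K L R) (hS : IsMeetRel L N S) (hT : IsMeetRel N O T) :
    star O (star O T S) R = star O T (star N S R) := by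
  refine ((hT.star hS).star hR).ext (hT.star (hS.star hR)) fun U hU => ?_
  rw [box_star O _ _ hU, box_star O _ _ hU, box_star O _ _ hU,
    box_star N _ _ (hT.box_mem U hU)]

end Spaces

/-! ### The category of MoS-spaces -/

/-- A MoS-space `⟨X, K, T⟩`: an S-space with a meet-relation on it. -/
structure MoSsp : Type (u + 1) where
  carrier : Type u
  K : Set (Set carrier)
  isSSpace : IsSSpace K
  T : SetRel carrier carrier
  isMeetRel : IsMeetRel K K T

namespace MoSsp

/-- Compatible meet-relations: meet-relations `M` with `M ∗ T₁ = T₂ ∗ M`. -/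
@[ext]
structure Hom (X Y : MoSsp.{u}) : Type u where
  rel : SetRel X.carrier Y.carrier
  isMeetRel : IsMeetRel X.K Y.K rel
  compatible : star Y.K rel X.T = star Y.K Y.T rel

/-- Identities are the dual specialization orders, and composition is `∗`. -/
instance : Category MoSsp.{u} where
  Hom := Hom
  id X :=
    { rel := dualSpec X.K
      isMeetRel := isMeetRel_dualSpec X.K
      compatible := by rw [dualSpec_star X.isMeetRel, star_dualSpec X.isMeetRel] }
  comp {X Y Z} M N :=
    { rel := star Z.K N.rel M.rel
      isMeetRel := N.isMeetRel.star M.isMeetRel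
      compatible := by
        rw [star_assoc X.isMeetRel M.isMeetRel N.isMeetRel, M.compatible,
          ← star_assoc M.isMeetRel Y.isMeetRel N.isMeetRel, N.compatible,
          star_assoc M.isMeetRel N.isMeetRel Z.isMeetRel] }
  id_comp M := Hom.ext (star_dualSpec M.isMeetRel)
  comp_id M := Hom.ext (dualSpec_star M.isMeetRel)
  assoc M N P := Hom.ext (star_assoc M.isMeetRel N.isMeetRel P.isMeetRel).symm

end MoSsp

/-! ### The category of modal semilattices -/

/-- A modal semilattice `⟨A, d⟩`: a meet-semilattice with greatest element, with an operator `d`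
that preserves binary meets and the greatest element. -/
structure MoSL : Type (u + 1) where
  carrier : Type u
  [semilatticeInf : SemilatticeInf carrier]
  [orderTop : OrderTop carrier]
  d : InfTopHom carrier carrier

namespace MoSL

attribute [instance] MoSL.semilatticeInf MoSL.orderTop

/-- Modal homomorphisms: semilattice homomorphisms that commute with the operators. -/
@[ext]
structure Hom (A B : MoSL.{u}) : Type u where
  hom : InfTopHom A.carrier B.carrier
  map_d : ∀ a, hom (A.d a) = B.d (hom a)

instance : Category MoSL.{u} where
  Hom := Hom
  id A := { hom := InfTopHom.id A.carrier, map_d := fun _ => rfl }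
  comp f g :=
    { hom := g.hom.comp f.hom
      map_d := fun a => by simp [f.map_d, g.map_d] }

end MoSL

/-! ### The functor from MoS-spaces to modal semilattices -/

theorem inter_mem_subClosed {X : Type u} {K : Set (Set X)} (hK : IsSSpace K) ⦃A B : Set X⦄
    (hA : A ∈ subClosed K) (hB : B ∈ subClosed K) : A ∩ B ∈ subClosed K := by
  rw [mem_subClosed] at *
  rw [Set.compl_inter]
  exact hK.union_mem _ hA _ hB

theorem univ_mem_subClosed {X : Type u} {K : Set (Set X)} (hK : IsSSpace K) :
    Set.univ ∈ subClosed K := by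
  rw [mem_subClosed, Set.compl_univ]
  exact hK.empty_mem

/-- The semilattice `⟨S(X), ∩, X⟩`. -/
abbrev MoSsp.S (X : MoSsp.{u}) : Type u := {A : Set X.carrier // A ∈ subClosed X.K}

instance (X : MoSsp.{u}) : SemilatticeInf X.S :=
  Subtype.semilatticeInf (inter_mem_subClosed X.isSSpace)

instance (X : MoSsp.{u}) : OrderTop X.S where
  top := ⟨Set.univ, univ_mem_subClosed X.isSSpace⟩
  le_top A := Set.subset_univ A.1

/-- `□_M : S(Y) → S(X)` as a semilattice homomorphism. -/
def boxHom {X Y : MoSsp.{u}} (M : SetRel X.carrier Y.carrier) (hM : IsMeetRel X.K Y.K M) :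
    InfTopHom Y.S X.S where
  toFun U := ⟨box M U.1, hM.box_mem U.1 U.2⟩
  map_inf' _ _ := Subtype.ext (Set.ext fun _ => Set.subset_inter_iff)
  map_top' := Subtype.ext (Set.ext fun _ => iff_of_true (Set.subset_univ _) trivial)

/-- `F : MoSsp → MoSLᵒᵖ`, with `⟨X, K, T⟩ ↦ ⟨S(X), □_T⟩` and `M ↦ □_M`. -/
def functorF : MoSsp.{u} ⥤ MoSL.{u}ᵒᵖ where
  obj X := Opposite.op { carrier := X.S, d := boxHom X.T X.isMeetRel }
  map {X Y} M := Quiver.Hom.op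
    (show MoSL.Hom { carrier := Y.S, d := boxHom Y.T Y.isMeetRel }
        { carrier := X.S, d := boxHom X.T X.isMeetRel } from
      { hom := boxHom M.rel M.isMeetRel
        map_d := fun U => Subtype.ext (by
          change box M.rel (box Y.T U.1) = box X.T (box M.rel U.1)
          rw [← box_star Y.K _ _ U.2, ← box_star Y.K _ _ U.2, M.compatible]) })
  map_id X := Quiver.Hom.unop_inj
    (MoSL.Hom.ext (DFunLike.ext _ _ fun U => Subtype.ext (box_dualSpec X.K U.2)))
  map_comp {X Y Z} M N := Quiver.Hom.unop_inj
    (MoSL.Hom.ext (DFunLike.ext _ _ fun U => Subtype.ext (box_star Z.K N.rel M.rel U.2)))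

/-! ### Irreducible filters and the functor from modal semilattices to MoS-spaces -/

section Filters

variable {A B C : Type u} [SemilatticeInf A] [OrderTop A] [SemilatticeInf B] [OrderTop B]
  [SemilatticeInf C] [OrderTop C]

/-- Filters of a semilattice. -/
structure IsFilter (F : Set A) : Prop where
  upset : ∀ a ∈ F, ∀ b, a ≤ b → b ∈ F
  top_mem : ⊤ ∈ F
  inf_mem : ∀ a ∈ F, ∀ b ∈ F, a ⊓ b ∈ F

/-- Irreducible filters: proper filters that are not the intersection of two filters different
from them. -/
structure IsIrreducibleFilter (P : Set A) : Prop where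
  isFilter : IsFilter P
  proper : P ≠ Set.univ
  irreducible : ∀ F₁ F₂ : Set A, IsFilter F₁ → IsFilter F₂ → P = F₁ ∩ F₂ → P = F₁ ∨ P = F₂

variable (A) in
/-- `𝒳(A)`, the set of irreducible filters. -/
abbrev Irr : Type u := {P : Set A // IsIrreducibleFilter P}

/-- `β(a)`, the set of irreducible filters that contain `a`. -/
def beta (a : A) : Set (Irr A) := {P | a ∈ P.1}

variable (A) in
/-- The subbase `{β(a)ᶜ | a ∈ A}` of `𝒳(A)`. -/
def irrSubbase : Set (Set (Irr A)) := {U | ∃ a : A, U = (beta a)ᶜ}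

/-- `N_h ⊆ 𝒳(B) × 𝒳(A)`, with `(P, Q) ∈ N_h` iff `h⁻¹[P] ⊆ Q`. -/
def filterRel (h : InfTopHom A B) : SetRel (Irr B) (Irr A) := {p | h ⁻¹' p.1.1 ⊆ p.2.1}

theorem mem_subClosed_irrSubbase {V : Set (Irr A)} :
    V ∈ subClosed (irrSubbase A) ↔ ∃ a, V = beta a := by
  rw [mem_subClosed]
  exact exists_congr fun a => compl_inj_iff

theorem beta_mem_subClosed (a : A) : beta a ∈ subClosed (irrSubbase A) :=
  mem_subClosed_irrSubbase.2 ⟨a, rfl⟩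

/-- Separation of a filter from a disjoint set that is directed relative to it. -/
theorem exists_irr {F I : Set A} (hF : IsFilter F) (hI : I.Nonempty)
    (hdir : ∀ a ∈ I, ∀ b ∈ I, ∃ h ∈ F, ∃ c ∈ I, a ⊓ h ≤ c ∧ b ⊓ h ≤ c)
    (hd : ∀ a ∈ I, a ∉ F) : ∃ P : Irr A, F ⊆ P.1 ∧ ∀ a ∈ I, a ∉ P.1 := by
  obtain ⟨P, hFP, hP⟩ := zorn_subset_nonempty {G : Set A | IsFilter G ∧ ∀ a ∈ I, a ∉ G}
    (by
      intro c hc hchain hne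
      refine ⟨⋃₀ c, ⟨⟨?_, ?_, ?_⟩, ?_⟩, fun s hs => Set.subset_sUnion_of_mem hs⟩
      · rintro a ⟨G, hG, ha⟩ b hab
        exact ⟨G, hG, (hc hG).1.upset a ha b hab⟩
      · obtain ⟨G, hG⟩ := hne
        exact ⟨G, hG, (hc hG).1.top_mem⟩
      · rintro a ⟨G, hG, ha⟩ b ⟨G', hG', hb⟩
        rcases hchain.total hG hG' with h | h
        · exact ⟨G', hG', (hc hG').1.inf_mem a (h ha) b hb⟩
        · exact ⟨G, hG, (hc hG).1.inf_mem a ha b (h hb)⟩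
      · rintro a ha ⟨G, hG, haG⟩
        exact (hc hG).2 a ha haG)
    F ⟨hF, hd⟩
  refine ⟨⟨P, hP.prop.1, ?_, ?_⟩, hFP, hP.prop.2⟩
  · rintro rfl
    obtain ⟨a, ha⟩ := hI
    exact hP.prop.2 a ha trivial
  · intro F₁ F₂ h₁ h₂ hPF
    by_contra! hne
    have aux : ∀ G : Set A, IsFilter G → P ⊆ G → P ≠ G → ∃ x ∈ I, x ∈ G := by
      intro G hG hPG hneG
      by_contra! hcon
      exact hneG (hPG.antisymm (hP.le_of_ge ⟨hG, hcon⟩ hPG))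
    obtain ⟨x, hxI, hx⟩ := aux F₁ h₁ (hPF ▸ Set.inter_subset_left) hne.1
    obtain ⟨y, hyI, hy⟩ := aux F₂ h₂ (hPF ▸ Set.inter_subset_right) hne.2
    obtain ⟨h, hh, c, hc, hxc, hyc⟩ := hdir x hxI y hyI
    have hhP : h ∈ F₁ ∩ F₂ := hPF ▸ hFP hh
    refine hP.prop.2 c hc ?_
    rw [hPF]
    exact ⟨h₁.upset _ (h₁.inf_mem x hx h hhP.1) c hxc,
      h₂.upset _ (h₂.inf_mem y hy h hhP.2) c hyc⟩

theorem mem_of_forall_irr {F : Set A} (hF : IsFilter F) {a : A}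
    (h : ∀ P : Irr A, F ⊆ P.1 → a ∈ P.1) : a ∈ F := by
  by_contra ha
  obtain ⟨P, hFP, hP⟩ := exists_irr hF (Set.singleton_nonempty a)
    (by
      rintro x rfl y rfl
      exact ⟨⊤, hF.top_mem, y, rfl, inf_le_left, inf_le_left⟩)
    (by
      rintro x rfl
      exact ha)
  exact hP a rfl (h P hFP)

theorem IsFilter.preimage {F : Set B} (hF : IsFilter F) (h : InfTopHom A B) :
    IsFilter (h ⁻¹' F) where
  upset a ha b hab := hF.upset _ ha _ (OrderHomClass.mono h hab)
  top_mem := by simpa using hF.top_mem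
  inf_mem a ha b hb := by simpa using hF.inf_mem _ ha _ hb

theorem box_filterRel (h : InfTopHom A B) (a : A) : box (filterRel h) (beta a) = beta (h a) := by
  ext P
  constructor
  · intro hP
    exact mem_of_forall_irr (P.2.isFilter.preimage h) fun Q hQ => hP hQ
  · intro hP Q hQ
    exact hQ hP

theorem isMeetRel_filterRel (h : InfTopHom A B) :
    IsMeetRel (irrSubbase B) (irrSubbase A) (filterRel h) where
  box_mem U hU := by
    obtain ⟨a, rfl⟩ := mem_subClosed_irrSubbase.1 hU
    rw [box_filterRel]
    exact beta_mem_subClosed _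
  fiber_eq P := by
    apply Set.Subset.antisymm
    · rintro Q hQ U ⟨-, hU⟩
      exact hU hQ
    · intro Q hQ a ha
      exact hQ (beta a) ⟨beta_mem_subClosed a, fun R hR => hR ha⟩

theorem filterRel_id : filterRel (InfTopHom.id A) = dualSpec (irrSubbase A) := by
  refine (isMeetRel_filterRel _).ext (isMeetRel_dualSpec _) fun U hU => ?_
  rw [box_dualSpec _ hU]
  obtain ⟨a, rfl⟩ := mem_subClosed_irrSubbase.1 hU
  exact box_filterRel _ a

theorem filterRel_comp (g : InfTopHom B C) (h : InfTopHom A B) :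
    filterRel (g.comp h) = star (irrSubbase A) (filterRel h) (filterRel g) := by
  refine (isMeetRel_filterRel _).ext ((isMeetRel_filterRel h).star (isMeetRel_filterRel g))
    fun U hU => ?_
  rw [box_star _ _ _ hU]
  obtain ⟨a, rfl⟩ := mem_subClosed_irrSubbase.1 hU
  rw [box_filterRel, box_filterRel, box_filterRel]
  rfl

theorem exists_of_irr (P : Irr A) {a b : A} (ha : a ∉ P.1) (hb : b ∉ P.1) :
    ∃ h ∈ P.1, ∃ c, c ∉ P.1 ∧ a ⊓ h ≤ c ∧ b ⊓ h ≤ c := by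
  have key : ∀ a : A, IsFilter {x | ∃ h ∈ P.1, a ⊓ h ≤ x} := by
    intro a
    refine ⟨?_, ⟨⊤, P.2.isFilter.top_mem, le_top⟩, ?_⟩
    · rintro x ⟨h, hh, hx⟩ y hxy
      exact ⟨h, hh, hx.trans hxy⟩
    · rintro x ⟨h, hh, hx⟩ y ⟨k, hk, hy⟩
      refine ⟨h ⊓ k, P.2.isFilter.inf_mem h hh k hk, le_inf ?_ ?_⟩
      · exact (inf_le_inf_left a inf_le_left).trans hx
      · exact (inf_le_inf_left a inf_le_right).trans hy
  by_contra! hcon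
  rcases P.2.irreducible _ _ (key a) (key b) (by
    apply Set.Subset.antisymm
    · intro x hx
      exact ⟨⟨x, hx, inf_le_right⟩, ⟨x, hx, inf_le_right⟩⟩
    · rintro x ⟨⟨h, hh, hx⟩, ⟨k, hk, hy⟩⟩
      by_contra hxP
      exact hcon (h ⊓ k) (P.2.isFilter.inf_mem h hh k hk) x hxP
        ((inf_le_inf_left a inf_le_left).trans hx)
        ((inf_le_inf_left b inf_le_right).trans hy)) with h | h
  · apply ha
    rw [h]
    exact ⟨⊤, P.2.isFilter.top_mem, inf_le_left⟩
  · apply hb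
    rw [h]
    exact ⟨⊤, P.2.isFilter.top_mem, inf_le_left⟩

variable (A) in
theorem isSSpace_irr : IsSSpace (irrSubbase A) where
  t0 := by
    let _ := TopologicalSpace.generateFrom (irrSubbase A)
    refine ⟨fun P Q hPQ => Subtype.ext (Set.ext fun a => ?_)⟩
    have := hPQ.mem_open_iff (s := (beta a)ᶜ) (TopologicalSpace.isOpen_generateFrom_of_mem ⟨a, rfl⟩)
    exact not_iff_not.1 this
  sUnion_eq := by
    refine Set.eq_univ_of_forall fun P => ?_
    obtain ⟨a, ha⟩ := (Set.ne_univ_iff_exists_notMem _).1 P.2.proper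
    exact ⟨(beta a)ᶜ, ⟨a, rfl⟩, ha⟩
  isCompact := by
    classical
    rintro _ ⟨a, rfl⟩
    let _ := TopologicalSpace.generateFrom (irrSubbase A)
    refine isCompact_generateFrom rfl fun Q hQ hcov => ?_
    have hF : IsFilter {x : A | ∃ s : Finset A, (∀ b ∈ s, (beta b)ᶜ ∈ Q) ∧ s.inf id ≤ x} := by
      refine ⟨?_, ⟨∅, by simp⟩, ?_⟩
      · rintro x ⟨s, hs, hx⟩ y hxy
        exact ⟨s, hs, hx.trans hxy⟩
      · rintro x ⟨s, hs, hx⟩ y ⟨t, ht, hy⟩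
        refine ⟨s ∪ t, ?_, ?_⟩
        · intro b hb
          rcases Finset.mem_union.1 hb with hb | hb
          · exact hs b hb
          · exact ht b hb
        · rw [Finset.inf_union]
          exact inf_le_inf hx hy
    obtain ⟨s, hs, hsa⟩ := mem_of_forall_irr hF (a := a) (by
      intro P hFP
      by_contra haP
      obtain ⟨U, hU, hPU⟩ := hcov (show P ∈ (beta a)ᶜ from haP)
      obtain ⟨b, rfl⟩ := hQ hU
      refine hPU (hFP ⟨{b}, ?_, by simp⟩)
      intro b' hb'
      rw [Finset.mem_singleton.1 hb']
      exact hU)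
    refine ⟨(fun b => (beta b)ᶜ) '' (s : Set A), ?_, s.finite_toSet.image _, ?_⟩
    · rintro _ ⟨b, hb, rfl⟩
      exact hs b hb
    · intro P hP
      by_contra hcon
      apply hP
      refine P.2.isFilter.upset _ ?_ a hsa
      have hmem : ∀ b ∈ s, b ∈ P.1 := by
        intro b hb
        by_contra hbP
        exact hcon ⟨(beta b)ᶜ, ⟨b, hb, rfl⟩, hbP⟩
      clear hsa hs hcon
      induction s using Finset.induction_on with
      | empty => simpa using P.2.isFilter.top_mem
      | insert b s _ ih =>
        rw [Finset.inf_insert]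
        exact P.2.isFilter.inf_mem _ (hmem b (by simp)) _
          (ih fun c hc => hmem c (Finset.mem_insert_of_mem hc))
  union_mem := by
    rintro _ ⟨a, rfl⟩ _ ⟨b, rfl⟩
    refine ⟨a ⊓ b, ?_⟩
    rw [← Set.compl_inter]
    congr 1
    ext P
    constructor
    · rintro ⟨ha, hb⟩
      exact P.2.isFilter.inf_mem a ha b hb
    · intro h
      exact ⟨P.2.isFilter.upset _ h _ inf_le_left, P.2.isFilter.upset _ h _ inf_le_right⟩
  empty_mem := by
    refine ⟨⊤, ?_⟩
    ext P
    simpa [beta] using P.2.isFilter.top_mem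
  s3 := by
    rintro _ ⟨a, rfl⟩ _ ⟨b, rfl⟩ P ⟨ha, hb⟩
    obtain ⟨h, hh, c, hc, hac, hbc⟩ := exists_of_irr P ha hb
    refine ⟨(beta h)ᶜ, ⟨h, rfl⟩, (beta c)ᶜ, ⟨c, rfl⟩, fun hn => hn hh, hc, ?_⟩
    intro Q hcQ
    by_cases hhQ : h ∈ Q.1
    · refine Or.inl ⟨fun haQ => hcQ ?_, fun hbQ => hcQ ?_⟩
      · exact Q.2.isFilter.upset _ (Q.2.isFilter.inf_mem a haQ h hhQ) c hac
      · exact Q.2.isFilter.upset _ (Q.2.isFilter.inf_mem b hbQ h hhQ) c hbc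
    · exact Or.inr hhQ
  s4 := by
    rintro Y ⟨𝒜, h𝒜, rfl⟩ J hJne ⟨hJ, hfam⟩ hne
    have hF : IsFilter {x : A | ⋂₀ 𝒜 ⊆ beta x} := by
      refine ⟨?_, ?_, ?_⟩
      · intro x hx y hxy P hP
        exact P.2.isFilter.upset _ (hx hP) y hxy
      · intro P _
        exact P.2.isFilter.top_mem
      · intro x hx y hy P hP
        exact P.2.isFilter.inf_mem x (hx hP) y (hy hP)
    have mono : ∀ a b h : A, (beta a ∩ beta h ⊆ beta b) → a ⊓ h ≤ b := by
      intro a b h hsub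
      have hup : IsFilter {x : A | a ⊓ h ≤ x} :=
        ⟨fun x hx y hxy => le_trans hx hxy, le_top, fun x hx y hy => le_inf hx hy⟩
      exact mem_of_forall_irr hup fun P hP => hsub ⟨hP inf_le_left, hP inf_le_right⟩
    obtain ⟨P, hFP, hP⟩ := exists_irr hF (I := {a | beta a ∈ J})
      (by
        obtain ⟨U, hU⟩ := hJne
        obtain ⟨a, rfl⟩ := mem_subClosed_irrSubbase.1 (hJ hU)
        exact ⟨a, hU⟩)
      (by
        intro a ha b hb
        obtain ⟨H, hH, D, hD, hYH, h₁, h₂⟩ := hfam _ ha _ hb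
        obtain ⟨h, rfl⟩ := mem_subClosed_irrSubbase.1 hH
        obtain ⟨c, rfl⟩ := mem_subClosed_irrSubbase.1 (hJ hD)
        exact ⟨h, hYH, c, hD, mono _ _ _ h₁, mono _ _ _ h₂⟩)
      (by
        intro a ha haF
        obtain ⟨Q, hQ, hQa⟩ := hne _ ha
        exact hQa (haF hQ))
    refine ⟨P, ?_, ?_⟩
    · intro U hU
      obtain ⟨a, rfl⟩ := mem_subClosed_irrSubbase.1 (h𝒜 hU)
      exact hFP (Set.sInter_subset_of_mem hU)
    · refine Set.mem_iInter₂.2 fun U hU => ?_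
      obtain ⟨a, rfl⟩ := mem_subClosed_irrSubbase.1 (hJ hU)
      exact hP a hU

end Filters

/-- `G : MoSLᵒᵖ → MoSsp`, with `⟨A, d⟩ ↦ ⟨𝒳(A), {β(a)ᶜ | a ∈ A}, N_d⟩` and `h ↦ N_h`. -/
def functorG : MoSL.{u}ᵒᵖ ⥤ MoSsp.{u} where
  obj A :=
    { carrier := Irr A.unop.carrier
      K := irrSubbase A.unop.carrier
      isSSpace := isSSpace_irr A.unop.carrier
      T := filterRel A.unop.d
      isMeetRel := isMeetRel_filterRel A.unop.d }
  map {A B} f :=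
    { rel := filterRel f.unop.hom
      isMeetRel := isMeetRel_filterRel f.unop.hom
      compatible := by
        rw [← filterRel_comp, ← filterRel_comp]
        congr 1
        exact DFunLike.ext _ _ fun a => (f.unop.map_d a).symm }
  map_id A := MoSsp.Hom.ext filterRel_id
  map_comp f g := MoSsp.Hom.ext (filterRel_comp f.unop.hom g.unop.hom)

end ModalDuality

namespace ModalDuality

/-! ### The unit: an S-space and the irreducible filters of its subbasic closed sets -/

namespace MoSsp

/-! A meet-relation is determined by its box operator, and boxes turn `∗` into ordinary composition
in reverse order. Every identity between morphisms of MoS-spaces can therefore be checked on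
subbasic closed sets.

For the unit, the relations `toIrr` (the point filter of x is contained in P) and `ofIrr` (x lies in
every member of P) have boxes β(U) ↦ U and U ↦ β(U), which are mutually inverse. The first,
`box_toIrr`, holds because a filter is the intersection of the irreducible filters above it, a form
of Zorn's lemma. The second, `box_ofIrr`, holds because complements of members of S(X) are compact:
a filter of S(X) contains every U that includes its intersection. Since isomorphisms are relations,
an irreducible filter need not be realised by a point.

For the counit, β embeds A into S(𝒳(A)) by the same separation of filters, and is onto by the choice
of subbase. Compatibility with the operators and naturality on both sides come from one formula,
□_{N_h}(β(a)) = β(h(a)). -/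

theorem hom_ext {X Y : MoSsp.{u}} {M N : X ⟶ Y}
    (h : ∀ U ∈ subClosed Y.K, box (Hom.rel M) U = box (Hom.rel N) U) : M = N :=
  Hom.ext ((Hom.isMeetRel M).ext (Hom.isMeetRel N) h)

theorem box_id (X : MoSsp.{u}) {U : Set X.carrier} (hU : U ∈ subClosed X.K) :
    box (Hom.rel (𝟙 X)) U = U :=
  box_dualSpec X.K hU

theorem box_comp {X Y Z : MoSsp.{u}} (M : X ⟶ Y) (N : Y ⟶ Z) {U : Set Z.carrier}
    (hU : U ∈ subClosed Z.K) :
    box (Hom.rel (M ≫ N)) U = box (Hom.rel M) (box (Hom.rel N) U) :=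
  box_star Z.K N.rel M.rel hU

/-! ### Points of X against irreducible filters of S(X) -/

variable (X : MoSsp.{u})

/-- The filter `{U ∈ S(X) | x ∈ U}`. -/
def pointFilter (x : X.carrier) : Set X.S := {U | x ∈ U.1}

theorem isFilter_pointFilter (x : X.carrier) : IsFilter (X.pointFilter x) where
  upset _ hU _ hUV := hUV hU
  top_mem := Set.mem_univ x
  inf_mem _ hU _ hV := ⟨hU, hV⟩

/-- The points and the irreducible filters that contain their point filters. -/
def toIrr : SetRel X.carrier (Irr X.S) := {p | X.pointFilter p.1 ⊆ p.2.1}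

/-- The irreducible filters and the points of their intersections. -/
def ofIrr : SetRel (Irr X.S) X.carrier := {p | p.1.1 ⊆ X.pointFilter p.2}

/-- The point filter of x is the intersection of the irreducible filters that contain it. -/
theorem box_toIrr (U : X.S) : box X.toIrr (beta U) = U.1 := by
  ext x
  constructor
  · intro h
    exact mem_of_forall_irr (X.isFilter_pointFilter x) fun P hP => h hP
  · intro hx P hP
    exact hP hx

/-- A filter of `S(X)` contains every member of `S(X)` that includes its intersection. -/
theorem mem_of_sInter_subset {F : Set X.S} (hF : IsFilter F) {U : X.S}
    (h : ∀ x, F ⊆ X.pointFilter x → x ∈ U.1) : U ∈ F := by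
  classical
  let _ := TopologicalSpace.generateFrom X.K
  -- The complement of U is compact by (S2). The complements of the members of F cover it, because a
  -- point in every member of F lies in U.
  obtain ⟨s, hs⟩ := (X.isSSpace.isCompact _ (mem_subClosed.1 U.2)).elim_finite_subcover
    (fun V : F => V.1.1ᶜ)
    (fun V => TopologicalSpace.isOpen_generateFrom_of_mem (mem_subClosed.1 V.1.2))
    (by
      intro x hx
      by_contra hcon
      refine hx (h x fun V hV => ?_)
      by_contra hxV
      exact hcon (Set.mem_iUnion.2 ⟨⟨V, hV⟩, hxV⟩))
  -- Finite meets of members of F stay in F. The empty meet is ⊤, as needed when the complement of U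
  -- is empty.
  have hinf : ∀ t : Finset F, ∃ W ∈ F, W.1 ⊆ ⋂ V ∈ t, V.1.1 := by
    intro t
    induction t using Finset.induction_on with
    | empty => exact ⟨⊤, hF.top_mem, by simp⟩
    | insert V t _ ih =>
      obtain ⟨W, hW, hWt⟩ := ih
      refine ⟨V.1 ⊓ W, hF.inf_mem _ V.2 _ hW, ?_⟩
      rw [Finset.set_biInter_insert]
      exact Set.inter_subset_inter_right _ hWt
  obtain ⟨W, hW, hWs⟩ := hinf s
  refine hF.upset W hW U fun x hx => ?_
  by_contra hxU
  obtain ⟨V, hV, hxV⟩ := Set.mem_iUnion₂.1 (hs hxU)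
  exact hxV (Set.mem_iInter₂.1 (hWs hx) V hV)

/-- The fibre of P is the intersection of its members, so compactness, through
`mem_of_sInter_subset`, gives the nontrivial inclusion. -/
theorem box_ofIrr (U : X.S) : box X.ofIrr U.1 = beta U := by
  ext P
  constructor
  · intro h
    exact X.mem_of_sInter_subset P.2.isFilter fun x hx => h hx
  · intro hU x hx
    exact hx hU

/-- The fibre of x is the intersection of the sets β(U) with x ∈ U, hence already closed. -/
theorem isMeetRel_toIrr : IsMeetRel X.K (irrSubbase X.S) X.toIrr where
  box_mem V hV := by
    obtain ⟨U, rfl⟩ := mem_subClosed_irrSubbase.1 hV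
    rw [box_toIrr]
    exact U.2
  fiber_eq x := by
    apply Set.Subset.antisymm
    · rintro P hP V ⟨-, hV⟩
      exact hV hP
    · intro P hP U hU
      exact hP (beta U) ⟨beta_mem_subClosed U, fun Q hQ => hQ hU⟩

theorem isMeetRel_ofIrr : IsMeetRel (irrSubbase X.S) X.K X.ofIrr where
  box_mem U hU := by
    rw [X.box_ofIrr ⟨U, hU⟩]
    exact beta_mem_subClosed _
  fiber_eq P := by
    apply Set.Subset.antisymm
    · rintro x hx V ⟨-, hV⟩
      exact hV hx
    · intro x hx U hU
      exact hx U.1 ⟨U.2, fun y hy => hy hU⟩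

/-- The component at `X` of the unit. -/
def unitHom : X ⟶ functorG.obj (functorF.obj X) :=
  show Hom _ _ from
  { rel := X.toIrr
    isMeetRel := X.isMeetRel_toIrr
    compatible := by
      -- Both composites have a box that sends β(U) to □_T(U).
      refine (X.isMeetRel_toIrr.star X.isMeetRel).ext
        ((isMeetRel_filterRel (boxHom X.T X.isMeetRel)).star X.isMeetRel_toIrr) fun V hV => ?_
      obtain ⟨U, rfl⟩ := mem_subClosed_irrSubbase.1 hV
      refine (box_star _ _ _ hV).trans (Eq.trans ?_ (box_star _ _ _ hV).symm)
      exact (congrArg (box X.T) (X.box_toIrr U)).trans ((X.box_toIrr _).symm.trans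
        (congrArg (box X.toIrr) (box_filterRel (boxHom X.T X.isMeetRel) U).symm)) }

/-- The inverse of the component at `X` of the unit. -/
def unitInv : functorG.obj (functorF.obj X) ⟶ X :=
  show Hom _ _ from
  { rel := X.ofIrr
    isMeetRel := X.isMeetRel_ofIrr
    compatible := by
      -- Both composites have a box that sends U to β(□_T(U)).
      refine (X.isMeetRel_ofIrr.star (isMeetRel_filterRel (boxHom X.T X.isMeetRel))).ext
        (X.isMeetRel.star X.isMeetRel_ofIrr) fun U hU => ?_
      refine (box_star _ _ _ hU).trans (Eq.trans ?_ (box_star _ _ _ hU).symm)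
      rw [X.box_ofIrr ⟨U, hU⟩, X.box_ofIrr ⟨_, X.isMeetRel.box_mem U hU⟩]
      exact box_filterRel _ _ }

/-- `X` is isomorphic to the space of irreducible filters of `S(X)`. -/
def unitIso : X ≅ functorG.obj (functorF.obj X) where
  hom := X.unitHom
  inv := X.unitInv
  hom_inv_id := by
    refine hom_ext fun U hU => ?_
    rw [box_comp _ _ hU, box_id X hU]
    exact (congrArg (box X.toIrr) (X.box_ofIrr ⟨U, hU⟩)).trans (X.box_toIrr ⟨U, hU⟩)
  inv_hom_id := by
    refine hom_ext fun V hV => ?_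
    rw [box_comp _ _ hV, box_id _ hV]
    obtain ⟨U, rfl⟩ := mem_subClosed_irrSubbase.1 hV
    exact (congrArg (box X.ofIrr) (X.box_toIrr U)).trans (X.box_ofIrr U)

end MoSsp

/-- The identity of `MoSsp` is naturally isomorphic to `G ∘ F`. -/
def unitNatIso : 𝟭 MoSsp.{u} ≅ functorF ⋙ functorG :=
  NatIso.ofComponents MoSsp.unitIso (by
    intro X Y M
    -- Both sides of the naturality square have a box that sends β(U) to □_M(U).
    refine MoSsp.hom_ext fun V hV => ?_
    refine (MoSsp.box_comp _ _ hV).trans (Eq.trans ?_ (MoSsp.box_comp _ _ hV).symm)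
    obtain ⟨U, rfl⟩ := mem_subClosed_irrSubbase.1 hV
    exact (congrArg (box M.rel) (Y.box_toIrr U)).trans ((X.box_toIrr _).symm.trans
      (congrArg (box X.toIrr) (box_filterRel (boxHom M.rel M.isMeetRel) U).symm)))

/-! ### The counit: a semilattice and the subbasic closed sets of its irreducible filters -/

section Beta

variable {A : Type u} [SemilatticeInf A] [OrderTop A]

theorem beta_inf (a b : A) : beta (a ⊓ b) = beta a ∩ beta b := by
  ext P
  exact ⟨fun h => ⟨P.2.isFilter.upset _ h _ inf_le_left, P.2.isFilter.upset _ h _ inf_le_right⟩,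
    fun h => P.2.isFilter.inf_mem a h.1 b h.2⟩

theorem beta_top : beta (⊤ : A) = Set.univ :=
  Set.eq_univ_of_forall fun P => P.2.isFilter.top_mem

/-- The principal filter of a is the intersection of the irreducible filters above it, all of which
lie in β(a) and so contain b. -/
theorem le_of_beta_subset {a b : A} (h : beta a ⊆ beta b) : a ≤ b :=
  mem_of_forall_irr (F := {x | a ≤ x})
    ⟨fun _ hx _ hxy => le_trans hx hxy, le_top, fun _ hx _ hy => le_inf hx hy⟩
    fun _ hP => h (hP le_rfl)

theorem beta_injective : Function.Injective (beta : A → Set (Irr A)) := fun _ _ h =>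
  le_antisymm (le_of_beta_subset h.subset) (le_of_beta_subset h.symm.subset)

end Beta

/-! ### The representation map β as a modal isomorphism -/

namespace MoSL

/-- A bijective modal homomorphism is an isomorphism. -/
noncomputable def isoOfBijective {A B : MoSL.{u}} (f : A ⟶ B)
    (hf : Function.Bijective (Hom.hom f)) : A ≅ B where
  hom := f
  inv :=
    let e := Equiv.ofBijective _ hf
    have he : ∀ b, Hom.hom f (e.symm b) = b := e.apply_symm_apply
    show Hom B A from
    { hom :=
        { toFun := e.symm
          -- Each law for the inverse is checked after applying the injective map f.
          map_inf' := fun a b => hf.1 (by rw [map_inf (Hom.hom f), he, he, he])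
          map_top' := hf.1 (by rw [map_top (Hom.hom f), he]) }
      map_d := fun b => hf.1 (by
        change Hom.hom f (e.symm (B.d b)) = Hom.hom f (A.d (e.symm b))
        rw [Hom.map_d f, he, he]) }
  hom_inv_id := Hom.ext (DFunLike.ext _ _ (Equiv.ofBijective _ hf).symm_apply_apply)
  inv_hom_id := Hom.ext (DFunLike.ext _ _ (Equiv.ofBijective _ hf).apply_symm_apply)

/-- The map `a ↦ β(a)` as a modal homomorphism. -/
def betaHom (A : MoSL.{u}) : A ⟶ (functorF.obj (functorG.obj (Opposite.op A))).unop :=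
  show Hom _ _ from
  { hom :=
      { toFun := fun a => ⟨beta a, beta_mem_subClosed a⟩
        map_inf' := fun a b => Subtype.ext (beta_inf a b)
        map_top' := Subtype.ext beta_top }
    map_d := fun a => Subtype.ext (box_filterRel A.d a).symm }

/-- Injectivity is separation by irreducible filters; surjectivity holds because S(𝒳(A)) consists of
the sets β(a) only. -/
theorem betaHom_bijective (A : MoSL.{u}) : Function.Bijective (Hom.hom A.betaHom) := by
  refine ⟨fun a b h => beta_injective (congrArg Subtype.val h), fun V => ?_⟩
  obtain ⟨a, ha⟩ := mem_subClosed_irrSubbase.1 V.2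
  exact ⟨a, Subtype.ext ha.symm⟩

end MoSL

/-- `F ∘ G` is naturally isomorphic to the identity of `MoSLᵒᵖ`. -/
noncomputable def counitNatIso : functorG ⋙ functorF ≅ 𝟭 MoSL.{u}ᵒᵖ :=
  NatIso.ofComponents
    (fun A => (MoSL.isoOfBijective A.unop.betaHom A.unop.betaHom_bijective).op) (by
    intro A B f
    refine Quiver.Hom.unop_inj (MoSL.Hom.ext (DFunLike.ext _ _ fun b => Subtype.ext ?_))
    -- In `MoSL` itself, naturality of β at f says that □_{N_f}(β(b)) = β(f(b)).
    exact box_filterRel f.unop.hom b)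

end ModalDuality

theorem mainTheorem3 :
    ∃ e : ModalDuality.MoSsp.{u} ≌ ModalDuality.MoSL.{u}ᵒᵖ,
      e.functor = ModalDuality.functorF ∧ e.inverse = ModalDuality.functorG := by
  -- No triangle identity has to be checked: `Equivalence.mk` adjusts the unit to satisfy it and
  -- leaves both functors unchanged.
  exact ⟨CategoryTheory.Equivalence.mk ModalDuality.functorF ModalDuality.functorG
    ModalDuality.unitNatIso ModalDuality.counitNatIso, rfl, rfl⟩
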